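/- Theorem 3.1. Let $n\ge 0$ and let $G=([n],\vec E)$ be a digraph with no loops and no 2-cycles, where $[n]=\{1,\dots,n\}$. Call a stationary Markov chain on a finite state space a 1-dependent uniform chain if the square of its transition matrix has all entries equal. Then there are a 1-dependent uniform chain $\mathbf X$ and $n$ identically distributed hitting times $T_1,\dots,T_n$ on $\mathbf X$, almost surely finite and pairwise almost surely distinct, such that for all $i,j\in[n]$ $$\mathbb P(T_j<T_i)>\tfrac12 \iff (i,j)\in\vec E,$$ that is, the ranking graph of $T_1,\dots,T_n$ is $G$. More precisely, let $N\ge n+1$ be any integer. There exist random variables $U_{m,r}$ ($m\in\mathbb N_0$, $r\in[n+1]$) that are i.i.d. and uniform on $[N]$. For any such family, on any probability space, let $X_m$ be the $(n+1)\times 2$ matrix whose columns are $(U_{m,r})_{r\in[n+1]}$ and $(U_{m+1,r})_{r\in[n+1]}$. For $\ell\in[n]$ let $R_\ell=(r^{(\ell)}_{a,b})$ be the $(n+1)\times2$ matrix with $r^{(\ell)}_{1,1}=r^{(\ell)}_{\ell+1,2}=\ell$; with $r^{(\ell)}_{a,2}=0$ for $a\ne\ell+1$; and, for $j\in[n]$,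 with $r^{(\ell)}_{j+1,1}=j$ if $(\ell,j)\in\vec E$ and $r^{(\ell)}_{j+1,1}=n+1$ otherwise. Let $T_\ell$ be the infimum (with $\inf\emptyset=\infty$) of the times $m\ge0$ at which $X_m$ agrees with $R_\ell$ in every nonzero entry of $R_\ell$. Then $\mathbf X=(X_m)_{m\ge0}$ is a 1-dependent uniform chain, and $T_1,\dots,T_n$ have all the properties stated above. -/

import Mathlib

open MeasureTheory ProbabilityTheory

/-- The alphabet `[N] = {1, …, N}`. -/
abbrev Letter (N : ℕ) : Type := {a : ℕ // a ∈ Finset.Icc 1 N}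

/-- `X` is a stationary (time-homogeneous) Markov chain under `P` on the finite state space `S`,
with transition matrix `Q` and initial law `π`: the law of each finite trajectory is
`π (x 0) * Q (x 0) (x 1) * ⋯ * Q (x (m - 1)) (x m)`, and `π` is invariant under `Q`. -/
structure IsStationaryMarkovChain {Ω S : Type*} [MeasurableSpace Ω] [Fintype S]
    (P : Measure Ω) (X : ℕ → Ω → S) (π : S → ℝ) (Q : Matrix S S ℝ) : Prop where
  measurableSet_eq : ∀ m s, MeasurableSet {ω | X m ω = s}
  init_nonneg : ∀ s, 0 ≤ π s
  init_sum : ∑ s, π s = 1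
  trans_nonneg : ∀ s t, 0 ≤ Q s t
  trans_sum : ∀ s, ∑ t, Q s t = 1
  invariant : ∀ t, ∑ s, π s * Q s t = π t
  trajectory : ∀ (m : ℕ) (x : ℕ → S),
    P.real {ω | ∀ l ≤ m, X l ω = x l} = π (x 0) * ∏ l ∈ Finset.range m, Q (x l) (x (l + 1))

/-- A 1-dependent uniform chain: a stationary Markov chain whose transition matrix has a square
with all entries equal. -/
def IsOneDependentUniformChain {Ω S : Type*} [MeasurableSpace Ω] [Fintype S]
    (P : Measure Ω) (X : ℕ → Ω → S) : Prop :=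
  ∃ (π : S → ℝ) (Q : Matrix S S ℝ), IsStationaryMarkovChain P X π Q ∧
    ∃ c : ℝ, ∀ s t, (Q * Q) s t = c

/-- The letters `U m i`, for `m : ℕ` and `i : Fin k`, are i.i.d. and uniform on `[N]`. -/
structure IsUniformLetters {Ω : Type*} [MeasurableSpace Ω] {N k : ℕ}
    (P : Measure Ω) (U : ℕ → Fin k → Ω → Letter N) : Prop where
  measurable : ∀ m i, Measurable (U m i)
  uniform : ∀ m i a, P.real {ω | U m i ω = a} = 1 / (N : ℝ)
  indep : iIndepFun (fun p : ℕ × Fin k => U p.1 p.2) P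

/-- The chain of `k × 2` matrices whose state at time `m` has the columns `U m` and `U (m + 1)`. -/
def columnPairChain {Ω : Type*} {N k : ℕ} (U : ℕ → Fin k → Ω → Letter N)
    (m : ℕ) (ω : Ω) : Matrix (Fin k) (Fin 2) (Letter N) :=
  Matrix.of fun i j => U (m + j) i ω

/-- A `k × 2` pattern with entries in `[M] ∪ {0}`: the first column has no zero, the second column
has exactly one nonzero entry. -/
structure Pattern (M k : ℕ) where
  entry : Matrix (Fin k) (Fin 2) ℕ
  entry_le : ∀ i j, entry i j ≤ M
  first_pos : ∀ i, 1 ≤ entry i 0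
  second_unique : ∃! i, entry i 1 ≠ 0

/-- The row of the nonzero entry in the second column of a pattern. -/
noncomputable def Pattern.hump {M k : ℕ} (R : Pattern M k) : Fin k :=
  R.second_unique.choose

/-- The projection `Π_h`: in the second column, all entries but the one in row `h` become `0`. -/
def projectHump {k : ℕ} (h : Fin k) (A : Matrix (Fin k) (Fin 2) ℕ) : Matrix (Fin k) (Fin 2) ℕ :=
  Matrix.of fun i j => if j = 1 ∧ i ≠ h then 0 else A i j

/-- The states in which the pattern `R` occurs. -/
def Pattern.states {M k : ℕ} (R : Pattern M k) (N : ℕ) :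
    Set (Matrix (Fin k) (Fin 2) (Letter N)) :=
  {A | projectHump R.hump (A.map Subtype.val) = R.entry}

/-- The first time, possibly `⊤`, at which the process `X` is in `A`. -/
noncomputable def hittingTime {Ω S : Type*} (X : ℕ → Ω → S) (A : Set S) (ω : Ω) : ℕ∞ :=
  hittingAfter X A 0 ω

/-- The ranking graph of a family of random variables: `(i, j)` is an arrow if and only if
`P (Y j < Y i) > 1 / 2`. -/
def rankingGraph {Ω ι α : Type*} [MeasurableSpace Ω] [LT α] (P : Measure Ω) (Y : ι → Ω → α) :
    Digraph ι where
  Adj i j := 1 / 2 < P.real {ω | Y j ω < Y i ω}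

open scoped Classical in
/-- The pattern generated by `G` at a vertex. Vertices and rows are numbered from `0` in `Fin`, so
the vertex `ℓ ∈ [n]` is `v : Fin n` with `ℓ = v + 1`, and the row `ℓ + 1` is `v.succ`. The pattern
has `ℓ` in row `1` of the first column and in row `ℓ + 1` of the second column; row `j + 1` of the
first column holds `j` if `(ℓ, j)` is an arrow, and `n + 1` otherwise. -/
noncomputable def generatedPattern {n : ℕ} (G : Digraph (Fin n)) (v : Fin n) :
    Pattern (n + 1) (n + 1) where
  entry := Matrix.of fun i j =>
    if j = 0 then
      Fin.cons (α := fun _ => ℕ) ((v : ℕ) + 1)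
        (fun u => if G.Adj v u then (u : ℕ) + 1 else n + 1) i
    else if i = v.succ then (v : ℕ) + 1 else 0
  entry_le i j := by
    have hv := v.isLt
    simp only [Matrix.of_apply]
    split_ifs
    · refine Fin.cases ?_ (fun u => ?_) i
      · simp only [Fin.cons_zero]; omega
      · have hu := u.isLt
        simp only [Fin.cons_succ]
        split_ifs <;> omega
    · omega
    · omega
  first_pos i := by
    simp only [Matrix.of_apply, if_true]
    refine Fin.cases ?_ (fun u => ?_) i
    · simp only [Fin.cons_zero]; omega
    · simp only [Fin.cons_succ]
      split_ifs <;> omega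
  second_unique := ⟨v.succ, by simp, fun i hi => by
    by_contra hne
    simp [hne] at hi⟩

/-- The hitting times, one for each vertex of `G`, of the patterns generated by `G` in the chain
of column pairs of `U`. -/
noncomputable def patternTime {Ω : Type*} {N n : ℕ} (G : Digraph (Fin n))
    (U : ℕ → Fin (n + 1) → Ω → Letter N) (v : Fin n) : Ω → ℕ∞ :=
  hittingTime (columnPairChain U) ((generatedPattern G v).states N)

/-! An occurrence of the pattern of `u` at time m puts the letter u + 1 in row `u.succ` of column m
+ 1. In that row the first column of the pattern of `v` has u + 1 if v → u, and the letter n + 1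
otherwise. So `v` can occur directly after `u` iff v → u (`disjoint_patternEvent_succ`,
`real_patternEvent_inter_succ_pos`); without loops no pattern directly follows itself.

Each occurrence has the same probability p, and an occurrence at time m is independent of those
before m - 1. Let A(s, m) be the event that no pattern from s occurs before m. Then P(A(s, m), w
occurs at m) ≤ p P(A(s, m - 1)), with equality if w can directly follow no element of s
(`real_avoid_inter`). For s = {w} equality gives a recursion for P(A(s, m)) that is the same for all
vertices and forces the limit 0: the times are identically distributed and finite. For s = {u, v},
sum over m. If `u` cannot follow `v`, then P(T_u < T_v) attains the bound; if `v` can follow `u`,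
then P(T_v < T_u) falls short of it (`real_first_time_lt_lt`). Ties are null, so the comparison is
one with 1/2. -/

/-! ### Independent uniform letters -/

section Letters

variable {Ω : Type*} {N k : ℕ} {U : ℕ → Fin k → Ω → Letter N}

/-- The σ-algebra generated by the letters with index in `S`. -/
@[reducible]
def letterAlgebra (U : ℕ → Fin k → Ω → Letter N) (S : Set (ℕ × Fin k)) : MeasurableSpace Ω :=
  ⨆ p ∈ S, MeasurableSpace.comap (U p.1 p.2) inferInstance

theorem measurableSet_letterAlgebra_eq {S : Set (ℕ × Fin k)} {m : ℕ} {i : Fin k}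
    (h : (m, i) ∈ S) (q : Letter N → Prop) :
    MeasurableSet[letterAlgebra U S] {ω | q (U m i ω)} := by
  have hle : MeasurableSpace.comap (U m i) inferInstance ≤ letterAlgebra U S :=
    le_iSup₂_of_le (f := fun (p : ℕ × Fin k) (_ : p ∈ S) =>
      MeasurableSpace.comap (U p.1 p.2) inferInstance) (m, i) h le_rfl
  exact hle _ ⟨{a | q a}, Set.Finite.measurableSet (Set.toFinite _), rfl⟩

variable [MeasurableSpace Ω] {P : Measure Ω}

theorem IsUniformLetters.measurableSet_eq (hU : IsUniformLetters P U) (m : ℕ) (i : Fin k)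
    (q : Letter N → Prop) : MeasurableSet {ω | q (U m i ω)} :=
  hU.measurable m i (Set.Finite.measurableSet (Set.toFinite {a | q a}))

theorem IsUniformLetters.real_inter_eq_mul (hU : IsUniformLetters P U)
    {S T : Set (ℕ × Fin k)} (hST : Disjoint S T) {A B : Set Ω}
    (hA : MeasurableSet[letterAlgebra U S] A) (hB : MeasurableSet[letterAlgebra U T] B) :
    P.real (A ∩ B) = P.real A * P.real B := by
  have h := indep_iSup_of_disjoint (fun p => (hU.measurable p.1 p.2).comap_le) hU.indep.iIndep hST
  rw [measureReal_def, (Indep_iff _ _ _).1 h A B hA hB, ENNReal.toReal_mul]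
  rfl

/-- Prescribing the letters with index in `S` has probability `(1 / N) ^ #S`. -/
theorem IsUniformLetters.real_cylinder (hU : IsUniformLetters P U) (S : Finset (ℕ × Fin k))
    (f : ℕ × Fin k → Letter N) :
    P.real {ω | ∀ p ∈ S, U p.1 p.2 ω = f p} = (1 / (N : ℝ)) ^ S.card := by
  have h := hU.indep.measure_inter_preimage_eq_mul S (sets := fun p => {f p})
    (fun p _ => measurableSet_singleton _)
  have he : {ω | ∀ p ∈ S, U p.1 p.2 ω = f p} =
      ⋂ p ∈ S, (fun ω => U p.1 p.2 ω) ⁻¹' {f p} := by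
    ext ω; simp
  rw [he, measureReal_def, h, ENNReal.toReal_prod]
  exact Finset.prod_eq_pow_card fun p _ => hU.uniform p.1 p.2 (f p)

/-- Prescribing the first `m` columns. -/
theorem IsUniformLetters.real_columns (hU : IsUniformLetters P U) (m : ℕ)
    (c : ℕ → Fin k → Letter N) :
    P.real {ω | ∀ l < m, ∀ i, U l i ω = c l i} = ((1 / (N : ℝ)) ^ k) ^ m := by
  have h := hU.real_cylinder (Finset.range m ×ˢ Finset.univ) (fun p => c p.1 p.2)
  rw [Finset.card_product, Finset.card_range, Finset.card_univ, Fintype.card_fin, mul_comm,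
    pow_mul] at h
  rw [← h]
  congr 1
  ext ω
  simp only [Set.mem_ofPred_eq, Finset.mem_product, Finset.mem_range, Finset.mem_univ, and_true,
    Prod.forall]
  exact ⟨fun H l i hl => H l hl i, fun H l hl i => H l i hl⟩

/-- Independent uniform letters exist. -/
theorem exists_isUniformLetters {N : ℕ} (hN : 0 < N) (k : ℕ) :
    ∃ (Ω : Type) (_ : MeasurableSpace Ω) (P : Measure Ω) (U : ℕ → Fin k → Ω → Letter N),
      IsProbabilityMeasure P ∧ IsUniformLetters P U := by
  have : Nonempty (Letter N) := ⟨⟨1, Finset.mem_Icc.2 ⟨le_rfl, hN⟩⟩⟩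
  let ν : Measure (Letter N) := (PMF.uniformOfFintype (Letter N)).toMeasure
  refine ⟨ℕ × Fin k → Letter N, inferInstance, Measure.infinitePi fun _ => ν,
    fun m i ω => ω (m, i), inferInstance, fun m i => measurable_pi_apply _, fun m i a => ?_, ?_⟩
  · have h : (Measure.infinitePi fun _ : ℕ × Fin k => ν).map (fun ω => ω (m, i)) = ν :=
      Measure.infinitePi_map_eval (fun _ : ℕ × Fin k => ν) (m, i)
    have h2 : (Measure.infinitePi fun _ : ℕ × Fin k => ν) {ω | ω (m, i) = a} = ν {a} := by
      have h3 := Measure.map_apply (μ := Measure.infinitePi fun _ : ℕ × Fin k => ν)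
        (measurable_pi_apply (m, i)) (measurableSet_singleton a)
      rw [h] at h3
      exact h3.symm
    rw [measureReal_def, h2, PMF.toMeasure_apply_singleton _ _ (measurableSet_singleton _)]
    simp
  · exact iIndepFun_infinitePi (P := fun _ : ℕ × Fin k => ν) (X := fun _ a => a)
      fun _ => measurable_id

end Letters

/-! ### The chain of column pairs -/

section ColumnPairs

variable {Ω : Type*} [MeasurableSpace Ω] {P : Measure Ω} {N k : ℕ} {U : ℕ → Fin k → Ω → Letter N}

open scoped Classical in
/-- The transition matrix of the chain of column pairs: the second column of the present state
becomes the first column of the next state, whose second column is uniform. -/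
noncomputable def columnPairTransition (N k : ℕ) :
    Matrix (Matrix (Fin k) (Fin 2) (Letter N)) (Matrix (Fin k) (Fin 2) (Letter N)) ℝ :=
  Matrix.of fun s t => if ∀ i, s i 1 = t i 0 then (1 / (N : ℝ)) ^ k else 0

/-- A `k × 2` matrix is a pair of columns. -/
def columnPairEquiv (α : Type*) (k : ℕ) :
    Matrix (Fin k) (Fin 2) α ≃ (Fin k → α) × (Fin k → α) where
  toFun s := (fun i => s i 0, fun i => s i 1)
  invFun p := Matrix.of fun i j => if j = 0 then p.1 i else p.2 i
  left_inv s := by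
    ext i j
    fin_cases j <;> simp
  right_inv p := by simp

theorem sum_ite_first_column {N k : ℕ} (c : Fin k → Letter N) [DecidablePred fun
    t : Matrix (Fin k) (Fin 2) (Letter N) => ∀ i, c i = t i 0] (x : ℝ) :
    ∑ t : Matrix (Fin k) (Fin 2) (Letter N), (if ∀ i, c i = t i 0 then x else 0) =
      (N : ℝ) ^ k * x := by
  classical
  rw [← Equiv.sum_comp (columnPairEquiv (Letter N) k).symm, Fintype.sum_prod_type]
  have h (a b : Fin k → Letter N) :
      (∀ i, c i = (columnPairEquiv (Letter N) k).symm (a, b) i 0) ↔ c = a := by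
    simp [columnPairEquiv, funext_iff]
  simp [h]

theorem sum_ite_second_column {N k : ℕ} (c : Fin k → Letter N) [DecidablePred fun
    t : Matrix (Fin k) (Fin 2) (Letter N) => ∀ i, t i 1 = c i] (x : ℝ) :
    ∑ t : Matrix (Fin k) (Fin 2) (Letter N), (if ∀ i, t i 1 = c i then x else 0) =
      (N : ℝ) ^ k * x := by
  classical
  rw [← Equiv.sum_comp (columnPairEquiv (Letter N) k).symm, Fintype.sum_prod_type_right]
  have h (a b : Fin k → Letter N) :
      (∀ i, (columnPairEquiv (Letter N) k).symm (a, b) i 1 = c i) ↔ b = c := by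
    simp [columnPairEquiv, funext_iff]
  simp [h]

/-- Exactly one intermediate state is possible: the second column of `s` followed by the first
column of `t`. -/
theorem columnPairTransition_sq {N k : ℕ} (hN : 0 < N)
    (s t : Matrix (Fin k) (Fin 2) (Letter N)) :
    (columnPairTransition N k * columnPairTransition N k) s t = ((1 / (N : ℝ)) ^ k) ^ 2 := by
  classical
  have hN' : (N : ℝ) ≠ 0 := by positivity
  rw [Matrix.mul_apply, Fintype.sum_eq_single
    ((columnPairEquiv (Letter N) k).symm (fun i => s i 1, fun i => t i 0))]
  · simp [columnPairTransition, columnPairEquiv, sq]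
  · intro u hu
    by_contra hne
    refine hu ((Equiv.eq_symm_apply _).2 ?_)
    simp only [columnPairTransition, Matrix.of_apply, mul_ite, ite_mul, zero_mul, mul_zero,
      ite_eq_right_iff, not_forall] at hne
    obtain ⟨h2, h1, -⟩ := hne
    simp only [columnPairEquiv, Equiv.coe_fn_mk, Prod.mk.injEq]
    exact ⟨funext fun i => (h1 i).symm, funext h2⟩

/-- Consecutive states share a column. If `x` respects this up to time `m`, its states prescribe m +
2 columns; otherwise both sides vanish. -/
theorem IsUniformLetters.columnPairChain_trajectory (hU : IsUniformLetters P U) (m : ℕ)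
    (x : ℕ → Matrix (Fin k) (Fin 2) (Letter N)) :
    P.real {ω | ∀ l ≤ m, columnPairChain U l ω = x l} = ((1 / (N : ℝ)) ^ k) ^ 2 *
      ∏ l ∈ Finset.range m, columnPairTransition N k (x l) (x (l + 1)) := by
  classical
  by_cases h : ∀ l < m, ∀ i, x l i 1 = x (l + 1) i 0
  · have hprod : ∏ l ∈ Finset.range m, columnPairTransition N k (x l) (x (l + 1)) =
        ((1 / (N : ℝ)) ^ k) ^ m := by
      rw [Finset.prod_congr rfl fun l hl => ?_, Finset.prod_const, Finset.card_range]
      exact if_pos (h l (Finset.mem_range.1 hl))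
    rw [hprod, ← pow_add, ← (show m + 2 = 2 + m by omega), ← hU.real_columns (m + 2)
      (fun l i => if l ≤ m then x l i 0 else x m i 1)]
    congr 1
    ext ω
    simp only [Set.mem_ofPred_eq]
    constructor
    · intro H l hl i
      split_ifs with hlm
      · have := congrFun (congrFun (H l hlm) i) 0
        simpa [columnPairChain] using this
      · obtain rfl : l = m + 1 := by omega
        have := congrFun (congrFun (H m le_rfl) i) 1
        simpa [columnPairChain] using this
    · intro H l hl
      ext1 i j
      fin_cases j
      · have := H l (by omega) i
        simpa [columnPairChain, hl] using this
      · have := H (l + 1) (by omega) i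
        rcases hl.eq_or_lt with rfl | hlt
        · simpa [columnPairChain] using this
        · rw [if_pos (by omega), ← h l hlt i] at this
          simpa [columnPairChain] using this
  · push Not at h
    obtain ⟨l, hl, i, hi⟩ := h
    rw [Finset.prod_eq_zero (Finset.mem_range.2 hl), mul_zero]
    · rw [show {ω | ∀ l ≤ m, columnPairChain U l ω = x l} = ∅ from ?_, measureReal_empty]
      refine Set.eq_empty_of_forall_notMem fun ω H => hi ?_
      rw [← H l hl.le, ← H (l + 1) hl]
      simp [columnPairChain]
    · exact if_neg fun H => hi (H i)

theorem IsUniformLetters.isOneDependentUniformChain (hU : IsUniformLetters P U) (hN : 0 < N) :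
    IsOneDependentUniformChain P (columnPairChain U) := by
  classical
  have hN' : (N : ℝ) ≠ 0 := by positivity
  refine ⟨fun _ => ((1 / (N : ℝ)) ^ k) ^ 2, columnPairTransition N k, ?_, _,
    columnPairTransition_sq hN⟩
  refine ⟨fun m s => ?_, fun s => by positivity, ?_, fun s t => ?_, fun s => ?_, fun t => ?_,
    hU.columnPairChain_trajectory⟩
  · have he : {ω | columnPairChain U m ω = s} =
        ⋂ i, ⋂ j : Fin 2, {ω | U (m + j) i ω = s i j} := by
      ext ω
      simp only [Set.mem_ofPred_eq, Set.mem_iInter, ← Matrix.ext_iff]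
      rfl
    rw [he]
    exact MeasurableSet.iInter fun i => MeasurableSet.iInter fun j =>
      hU.measurableSet_eq _ _ (· = s i j)
  · rw [← Equiv.sum_comp (columnPairEquiv (Letter N) k).symm]
    simp
    field_simp
  · simp only [columnPairTransition, Matrix.of_apply]
    split_ifs <;> positivity
  · simp only [columnPairTransition, Matrix.of_apply]
    rw [sum_ite_first_column fun i => s i 1, ← mul_pow, mul_one_div_cancel hN', one_pow]
  · simp only [columnPairTransition, Matrix.of_apply]
    rw [← Finset.mul_sum, sum_ite_second_column fun i => t i 0, ← mul_pow,
      mul_one_div_cancel hN', one_pow, mul_one]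

end ColumnPairs

/-! ### First occurrence times of abstract events -/

section FirstTimes

/-- None of the events `E u l` with `u ∈ s` and `l < m` occurs. -/
def avoid {Ω ι : Type*} (E : ι → ℕ → Set Ω) (s : Set ι) (m : ℕ) : Set Ω :=
  {ω | ∀ u ∈ s, ∀ l < m, ω ∉ E u l}

/-- Events `E v m` of the same probability `p`, disjoint for fixed `m`, such that `E v (m + 1)` is
independent of the events before time `m`. -/
structure IsUniformOccurrence {Ω ι : Type*} [MeasurableSpace Ω] (P : Measure Ω)
    (E : ι → ℕ → Set Ω) (p : ℝ) : Prop where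
  measurable : ∀ v m, MeasurableSet (E v m)
  prob : ∀ v m, P.real (E v m) = p
  pos : 0 < p
  disjoint : ∀ u v m, u ≠ v → Disjoint (E u m) (E v m)
  indep : ∀ s m v, P.real (avoid E s m ∩ E v (m + 1)) = P.real (avoid E s m) * p

variable {Ω ι : Type*} {E : ι → ℕ → Set Ω}

theorem avoid_zero (s : Set ι) : avoid E s 0 = Set.univ := by
  simp [avoid]

theorem avoid_anti (s : Set ι) {l m : ℕ} (h : l ≤ m) : avoid E s m ⊆ avoid E s l :=
  fun _ hω u hu r hr => hω u hu r (hr.trans_le h)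

theorem avoid_succ (s : Set ι) (m : ℕ) :
    avoid E s (m + 1) = avoid E s m \ ⋃ u ∈ s, E u m := by
  ext ω
  simp only [avoid, Order.lt_add_one_iff, Set.mem_ofPred_eq, Set.mem_sdiff, Set.mem_iUnion,
    not_exists]
  refine ⟨fun H => ⟨fun u hu l hl => H u hu l hl.le, fun u hu => H u hu m le_rfl⟩, ?_⟩
  rintro ⟨H, H'⟩ u hu l hl
  rcases hl.eq_or_lt with rfl | hl
  · exact H' u hu
  · exact H u hu l hl

variable {T : ι → Ω → ℕ∞}

/-- The hypothesis `hT` characterises `T v` as the first time of `E v`, the value `⊤` included. -/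
theorem first_time_eq_iff (hT : ∀ v ω (m : ℕ), (m : ℕ∞) ≤ T v ω ↔ ∀ l < m, ω ∉ E v l)
    (v : ι) (ω : Ω) (m : ℕ) : T v ω = m ↔ ω ∈ avoid E {v} m ∩ E v m := by
  have h1 := hT v ω m
  have h2 := hT v ω (m + 1)
  have h3 : T v ω = m ↔ (m : ℕ∞) ≤ T v ω ∧ ¬ ((m + 1 : ℕ) : ℕ∞) ≤ T v ω := by
    rw [Nat.cast_add_one, ENat.add_one_le_iff (ENat.natCast_ne_top m), not_lt]
    exact ⟨fun h => ⟨h.ge, h.le⟩, fun h => h.2.antisymm h.1⟩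
  rw [h3, h1, h2]
  simp only [avoid, Set.mem_inter_iff, Set.mem_ofPred_eq, Set.mem_singleton_iff, forall_eq]
  refine and_congr_right fun h => ?_
  push Not
  constructor
  · rintro ⟨l, hl, hl'⟩
    obtain rfl : l = m := by
      by_contra hne
      exact h l (by omega) hl'
    exact hl'
  · exact fun hm => ⟨m, by omega, hm⟩

variable [MeasurableSpace Ω] {P : Measure Ω} {p : ℝ}

namespace IsUniformOccurrence

theorem measurableSet_avoid [Countable ι] (hE : IsUniformOccurrence P E p) (s : Set ι) (m : ℕ) :
    MeasurableSet (avoid E s m) := by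
  rw [show avoid E s m = ⋂ u ∈ s, ⋂ l < m, (E u l)ᶜ by ext; simp [avoid]]
  exact .biInter (Set.to_countable s) fun u _ => .iInter fun l => .iInter fun _ =>
    (hE.measurable u l).compl

variable [IsProbabilityMeasure P]

/-- The truncated m - 1 is harmless: at m = 0 nothing has to be avoided. -/
theorem real_avoid_pred_inter (hE : IsUniformOccurrence P E p) (s : Set ι) (v : ι) (m : ℕ) :
    P.real (avoid E s (m - 1) ∩ E v m) = P.real (avoid E s (m - 1)) * p := by
  cases m with
  | zero => simp [avoid_zero, hE.prob]
  | succ m => exact hE.indep s m v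

theorem real_avoid_inter_le (hE : IsUniformOccurrence P E p) (s : Set ι) (v : ι) (m : ℕ) :
    P.real (avoid E s m ∩ E v m) ≤ P.real (avoid E s (m - 1)) * p := by
  rw [← hE.real_avoid_pred_inter]
  exact measureReal_mono (Set.inter_subset_inter_left _ (avoid_anti s (Nat.sub_le m 1)))

/-- If `v` cannot occur directly after an element of `s`, then avoiding `s` just before an
occurrence of `v` is automatic. -/
theorem real_avoid_inter (hE : IsUniformOccurrence P E p) {s : Set ι} {v : ι}
    (h : ∀ u ∈ s, ∀ m, Disjoint (E u m) (E v (m + 1))) (m : ℕ) :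
    P.real (avoid E s m ∩ E v m) = P.real (avoid E s (m - 1)) * p := by
  rw [← hE.real_avoid_pred_inter]
  cases m with
  | zero => rfl
  | succ m =>
    congr 1
    refine Set.Subset.antisymm
      (Set.inter_subset_inter_left _ (avoid_anti s (Nat.sub_le _ 1))) fun ω hω => ⟨?_, hω.2⟩
    rw [avoid_succ]
    refine ⟨hω.1, fun hω' => ?_⟩
    obtain ⟨u, hu, hu'⟩ := Set.mem_iUnion₂.1 hω'
    exact (h u hu m).notMem_of_mem_left hu' hω.2

/-- The loss from `m` to m + 1 is the probability of a first occurrence at `m`, which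
`real_avoid_inter` evaluates. -/
theorem real_avoid_singleton_succ (hE : IsUniformOccurrence P E p) {v : ι}
    (h : ∀ m, Disjoint (E v m) (E v (m + 1))) (m : ℕ) :
    P.real (avoid E {v} (m + 1)) =
      P.real (avoid E {v} m) - P.real (avoid E {v} (m - 1)) * p := by
  rw [← hE.real_avoid_inter (s := {v}) (v := v) (by simpa using h) m, avoid_succ,
    ← measureReal_inter_add_sdiff (s := avoid E {v} m) (hE.measurable v m)]
  simp

theorem real_avoid_singleton_congr (hE : IsUniformOccurrence P E p) {u v : ι}
    (hu : ∀ m, Disjoint (E u m) (E u (m + 1))) (hv : ∀ m, Disjoint (E v m) (E v (m + 1)))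
    (m : ℕ) : P.real (avoid E {u} m) = P.real (avoid E {v} m) := by
  induction m using Nat.strong_induction_on with
  | _ m ih =>
    cases m with
    | zero => simp [avoid_zero]
    | succ m =>
      rw [hE.real_avoid_singleton_succ hu, hE.real_avoid_singleton_succ hv, ih m (by omega),
        ih (m - 1) (by omega)]

theorem tendsto_real_avoid_singleton (hE : IsUniformOccurrence P E p) {v : ι}
    (h : ∀ m, Disjoint (E v m) (E v (m + 1))) :
    Filter.Tendsto (fun m => P.real (avoid E {v} m)) Filter.atTop (nhds 0) := by
  have hanti : Antitone fun m => P.real (avoid E {v} m) := fun l m hlm =>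
    measureReal_mono (avoid_anti _ hlm)
  have hL := tendsto_atTop_ciInf hanti ⟨0, by rintro _ ⟨m, rfl⟩; exact measureReal_nonneg⟩
  set L := ⨅ m, P.real (avoid E {v} m)
  have h1 := hL.comp (Filter.tendsto_add_atTop_nat 1)
  have h2 := hL.comp (Filter.tendsto_add_atTop_nat 2)
  have h3 := h1.sub (hL.mul_const p)
  have he : (fun m => P.real (avoid E {v} m)) ∘ (fun m => m + 2) = fun m =>
      ((fun m => P.real (avoid E {v} m)) ∘ fun m => m + 1) m - P.real (avoid E {v} m) * p :=
    funext fun m => hE.real_avoid_singleton_succ h (m + 1)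
  rw [he] at h2
  -- Passing to the limit in the recursion gives L = L - L p.
  have hLp := tendsto_nhds_unique h2 h3
  have hL0 : L = 0 := by
    have : L * p = 0 := by linarith
    exact (mul_eq_zero.1 this).resolve_right hE.pos.ne'
  rwa [hL0] at hL

end IsUniformOccurrence

/-! ### Laws and comparison of first times -/

namespace IsUniformOccurrence

theorem setOf_first_time_lt (hE : IsUniformOccurrence P E p)
    (hT : ∀ v ω (m : ℕ), (m : ℕ∞) ≤ T v ω ↔ ∀ l < m, ω ∉ E v l) {u v : ι} (huv : u ≠ v) :
    {ω | T u ω < T v ω} = ⋃ m, avoid E {u, v} m ∩ E u m := by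
  ext ω
  simp only [Set.mem_ofPred_eq, Set.mem_iUnion]
  constructor
  · intro hlt
    obtain ⟨m, hm⟩ := ENat.ne_top_iff_exists.1 hlt.ne_top
    have hu := (first_time_eq_iff hT u ω m).1 hm.symm
    have hv := (hT v ω m).1 (hm ▸ hlt.le)
    refine ⟨m, ?_, hu.2⟩
    rintro w (rfl | rfl)
    · exact hu.1 w rfl
    · exact hv
  · rintro ⟨m, hm, hum⟩
    have hu : T u ω = m := (first_time_eq_iff hT u ω m).2 ⟨by
      rintro w rfl; exact hm w (by simp), hum⟩
    rw [hu, ← ENat.add_one_le_iff (ENat.natCast_ne_top m), ← Nat.cast_add_one, hT]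
    intro l hl
    -- At time `m` itself `v` is excluded because `u` occurs then.
    rcases (Nat.lt_succ_iff.1 hl).eq_or_lt with rfl | hl
    · exact (hE.disjoint u v l huv).notMem_of_mem_left hum
    · exact hm v (by simp) l hl

theorem measurable_first_time [Countable ι] (hE : IsUniformOccurrence P E p)
    (hT : ∀ v ω (m : ℕ), (m : ℕ∞) ≤ T v ω ↔ ∀ l < m, ω ∉ E v l) (v : ι) : Measurable (T v) := by
  have hm (m : ℕ) : MeasurableSet (T v ⁻¹' {(m : ℕ∞)}) := by
    rw [show T v ⁻¹' {(m : ℕ∞)} = avoid E {v} m ∩ E v m from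
      Set.ext fun ω => first_time_eq_iff hT v ω m]
    exact (hE.measurableSet_avoid _ m).inter (hE.measurable v m)
  refine measurable_to_countable' fun a => ?_
  induction a using ENat.recTopCoe with
  | coe m => exact hm m
  | top =>
    rw [show T v ⁻¹' {⊤} = (⋃ m : ℕ, T v ⁻¹' {(m : ℕ∞)})ᶜ from ?_]
    · exact (MeasurableSet.iUnion hm).compl
    · ext ω
      simp [ENat.eq_top_iff_forall_ne, eq_comm]

theorem measurableSet_first_time_lt [Countable ι] (hE : IsUniformOccurrence P E p)
    (hT : ∀ v ω (m : ℕ), (m : ℕ∞) ≤ T v ω ↔ ∀ l < m, ω ∉ E v l) (u v : ι) :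
    MeasurableSet {ω | T u ω < T v ω} :=
  ((hE.measurable_first_time hT u).prodMk (hE.measurable_first_time hT v))
    (MeasurableSet.of_discrete (s := {x : ℕ∞ × ℕ∞ | x.1 < x.2}))

variable [IsProbabilityMeasure P]

theorem measure_first_time_eq_top (hE : IsUniformOccurrence P E p)
    (hT : ∀ v ω (m : ℕ), (m : ℕ∞) ≤ T v ω ↔ ∀ l < m, ω ∉ E v l) {v : ι}
    (h : ∀ m, Disjoint (E v m) (E v (m + 1))) : P {ω | T v ω = ⊤} = 0 := by
  have hle (m : ℕ) : P.real {ω | T v ω = ⊤} ≤ P.real (avoid E {v} m) := by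
    refine measureReal_mono fun ω hω => ?_
    rintro u rfl
    exact (hT u ω m).1 (le_top.trans_eq (Eq.symm hω))
  have h0 := ge_of_tendsto' (hE.tendsto_real_avoid_singleton h) hle
  exact (measureReal_eq_zero_iff).1 (h0.antisymm measureReal_nonneg)

theorem identDistrib_first_time [Countable ι] (hE : IsUniformOccurrence P E p)
    (hT : ∀ v ω (m : ℕ), (m : ℕ∞) ≤ T v ω ↔ ∀ l < m, ω ∉ E v l) {u v : ι}
    (hu : ∀ m, Disjoint (E u m) (E u (m + 1))) (hv : ∀ m, Disjoint (E v m) (E v (m + 1))) :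
    IdentDistrib (T u) (T v) P P := by
  have hmeas := hE.measurable_first_time hT
  refine ⟨(hmeas u).aemeasurable, (hmeas v).aemeasurable, Measure.ext_of_singleton fun a => ?_⟩
  rw [Measure.map_apply (hmeas u) (measurableSet_singleton a),
    Measure.map_apply (hmeas v) (measurableSet_singleton a)]
  induction a using ENat.recTopCoe with
  | top =>
    exact (hE.measure_first_time_eq_top hT hu).trans (hE.measure_first_time_eq_top hT hv).symm
  | coe m =>
    have h (w : ι) : T w ⁻¹' {(m : ℕ∞)} = avoid E {w} m ∩ E w m :=
      Set.ext fun ω => first_time_eq_iff hT w ω m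
    rw [h, h, ← measureReal_eq_measureReal_iff,
      hE.real_avoid_inter (by simpa using hu), hE.real_avoid_inter (by simpa using hv),
      hE.real_avoid_singleton_congr hu hv]

/-- Simultaneous events are disjoint, so a tie is possible only at `⊤`. -/
theorem measure_first_time_eq (hE : IsUniformOccurrence P E p)
    (hT : ∀ v ω (m : ℕ), (m : ℕ∞) ≤ T v ω ↔ ∀ l < m, ω ∉ E v l) {u v : ι} (huv : u ≠ v)
    (h : ∀ m, Disjoint (E u m) (E u (m + 1))) : P {ω | T u ω = T v ω} = 0 := by
  refine measure_mono_null (fun ω hω => ?_) (hE.measure_first_time_eq_top hT h)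
  simp only [Set.mem_ofPred_eq] at hω ⊢
  by_contra hne
  obtain ⟨m, hm⟩ := ENat.ne_top_iff_exists.1 hne
  exact (hE.disjoint u v m huv).notMem_of_mem_left
    ((first_time_eq_iff hT u ω m).1 hm.symm).2
    ((first_time_eq_iff hT v ω m).1 (hω ▸ hm.symm)).2

theorem hasSum_first_time_lt [Countable ι] (hE : IsUniformOccurrence P E p)
    (hT : ∀ v ω (m : ℕ), (m : ℕ∞) ≤ T v ω ↔ ∀ l < m, ω ∉ E v l) {u v : ι} (huv : u ≠ v) :
    HasSum (fun m => P.real (avoid E {u, v} m ∩ E u m)) (P.real {ω | T u ω < T v ω}) := by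
  rw [hE.setOf_first_time_lt hT huv]
  have hmeas (m : ℕ) : MeasurableSet (avoid E {u, v} m ∩ E u m) :=
    (hE.measurableSet_avoid _ m).inter (hE.measurable u m)
  have hdisj : Pairwise (Function.onFun Disjoint fun m => avoid E {u, v} m ∩ E u m) := by
    intro l m hlm
    rcases hlm.lt_or_gt with h | h
    · exact Set.disjoint_left.2 fun ω hl hm => hm.1 u (by simp) l h hl.2
    · exact Set.disjoint_left.2 fun ω hl hm => hl.1 u (by simp) m h hm.2
  have h := measure_iUnion (μ := P) hdisj hmeas
  rw [measureReal_def, h, ENNReal.tsum_toReal_eq fun m => measure_ne_top P _]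
  exact ENNReal.hasSum_toReal (h ▸ measure_ne_top P _)

theorem real_first_time_lt_add [Countable ι] (hE : IsUniformOccurrence P E p)
    (hT : ∀ v ω (m : ℕ), (m : ℕ∞) ≤ T v ω ↔ ∀ l < m, ω ∉ E v l) {u v : ι} (huv : u ≠ v)
    (h : ∀ m, Disjoint (E u m) (E u (m + 1))) :
    P.real {ω | T u ω < T v ω} + P.real {ω | T v ω < T u ω} = 1 := by
  have hlt := hE.measurableSet_first_time_lt hT
  have hdisj : Disjoint {ω | T u ω < T v ω} {ω | T v ω < T u ω} :=
    Set.disjoint_left.2 fun ω (h1 : T u ω < T v ω) (h2 : T v ω < T u ω) =>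
      lt_asymm h1 h2
  rw [← measureReal_union hdisj (hlt v u), measureReal_def,
    (prob_compl_eq_zero_iff ((hlt u v).union (hlt v u))).1, ENNReal.toReal_one]
  refine measure_mono_null (fun ω hω => ?_) (hE.measure_first_time_eq hT huv h)
  simp only [Set.mem_compl_iff, Set.mem_union, Set.mem_ofPred_eq, not_or, not_lt] at hω ⊢
  exact hω.2.antisymm hω.1

/-- The general upper bound for the term of `v` is the exact value of the term of `u`. -/
theorem real_avoid_inter_le_of_disjoint (hE : IsUniformOccurrence P E p) {u v : ι}
    (hu : ∀ m, Disjoint (E u m) (E u (m + 1))) (huv : ∀ m, Disjoint (E v m) (E u (m + 1)))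
    (m : ℕ) : P.real (avoid E {v, u} m ∩ E v m) ≤ P.real (avoid E {u, v} m ∩ E u m) := by
  rw [hE.real_avoid_inter (s := {u, v}), Set.pair_comm]
  · exact hE.real_avoid_inter_le _ v m
  · rintro w (rfl | rfl)
    exacts [hu, huv]

/-- If `u` cannot occur directly after `v`, then `u` is not less likely than `v` to come first. -/
theorem real_first_time_lt_le [Countable ι] (hE : IsUniformOccurrence P E p)
    (hT : ∀ v ω (m : ℕ), (m : ℕ∞) ≤ T v ω ↔ ∀ l < m, ω ∉ E v l) {u v : ι} (hne : u ≠ v)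
    (hu : ∀ m, Disjoint (E u m) (E u (m + 1))) (huv : ∀ m, Disjoint (E v m) (E u (m + 1))) :
    P.real {ω | T v ω < T u ω} ≤ P.real {ω | T u ω < T v ω} :=
  hasSum_le (hE.real_avoid_inter_le_of_disjoint hu huv) (hE.hasSum_first_time_lt hT hne.symm)
    (hE.hasSum_first_time_lt hT hne)

/-- If `u` cannot occur directly after `v`, but `v` can occur directly after `u`, then `u` is more
likely than `v` to come first. -/
theorem real_first_time_lt_lt [Countable ι] (hE : IsUniformOccurrence P E p)
    (hT : ∀ v ω (m : ℕ), (m : ℕ∞) ≤ T v ω ↔ ∀ l < m, ω ∉ E v l) {u v : ι} (hne : u ≠ v)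
    (hu : ∀ m, Disjoint (E u m) (E u (m + 1))) (huv : ∀ m, Disjoint (E v m) (E u (m + 1)))
    (hpos : 0 < P.real (E u 0 ∩ E v 1)) :
    P.real {ω | T v ω < T u ω} < P.real {ω | T u ω < T v ω} := by
  -- At time 0 both terms equal `p`. At time 1 the term of `u` is still `p`, while that of `v` loses
  -- at least P(E u 0 ∩ E v 1).
  refine hasSum_lt (i := 1) (hE.real_avoid_inter_le_of_disjoint hu huv) ?_
    (hE.hasSum_first_time_lt hT hne.symm) (hE.hasSum_first_time_lt hT hne)
  rw [hE.real_avoid_inter (s := {u, v})]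
  · have hsub : avoid E {v, u} 1 ∩ E v 1 ⊆ E v 1 \ E u 0 := fun ω hω =>
      ⟨hω.2, hω.1 u (by simp) 0 one_pos⟩
    have h1 := measureReal_mono (μ := P) hsub
    have h2 := measureReal_inter_add_sdiff (μ := P) (s := E v 1) (hE.measurable u 0)
    rw [hE.prob, Set.inter_comm] at h2
    simp only [Nat.sub_self, avoid_zero, probReal_univ, one_mul]
    linarith
  · rintro w (rfl | rfl)
    exacts [hu, huv]

end IsUniformOccurrence

end FirstTimes

/-! ### Overlaps and probabilities of the generated patterns -/

section GeneratedPatterns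

variable {Ω : Type*} {N n : ℕ} {G : Digraph (Fin n)} {U : ℕ → Fin (n + 1) → Ω → Letter N}

theorem generatedPattern_entry_zero_zero (G : Digraph (Fin n)) (v : Fin n) :
    (generatedPattern G v).entry 0 0 = v + 1 := by
  simp [generatedPattern]

/-- The filler n + 1 differs from every u + 1, since u < n. -/
theorem generatedPattern_entry_succ_zero_eq_iff (G : Digraph (Fin n)) (v u : Fin n) :
    (generatedPattern G v).entry u.succ 0 = u + 1 ↔ G.Adj v u := by
  have := u.isLt
  by_cases h : G.Adj v u
  · simp [generatedPattern, h]
  · simp only [generatedPattern, Matrix.of_apply, if_true, Fin.cons_succ, h, if_false, iff_false]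
    omega

theorem generatedPattern_hump (G : Digraph (Fin n)) (v : Fin n) :
    (generatedPattern G v).hump = v.succ := by
  by_contra hne
  refine (generatedPattern G v).second_unique.choose_spec.1 ?_
  change (generatedPattern G v).entry (generatedPattern G v).hump 1 = 0
  exact if_neg hne

/-- The event that the pattern generated by `G` at `v` occurs at time `m`. -/
def patternEvent (G : Digraph (Fin n)) (U : ℕ → Fin (n + 1) → Ω → Letter N) (v : Fin n)
    (m : ℕ) : Set Ω :=
  {ω | (∀ i, (U m i ω : ℕ) = (generatedPattern G v).entry i 0) ∧
    (U (m + 1) v.succ ω : ℕ) = v + 1}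

theorem columnPairChain_mem_states_iff (v : Fin n) (m : ℕ) (ω : Ω) :
    columnPairChain U m ω ∈ (generatedPattern G v).states N ↔ ω ∈ patternEvent G U v m := by
  simp only [Pattern.states, Set.mem_ofPred_eq, generatedPattern_hump, patternEvent,
    ← Matrix.ext_iff, Fin.forall_fin_two, projectHump, Matrix.of_apply, Matrix.map_apply,
    columnPairChain]
  rw [forall_and]
  refine and_congr (by simp) ⟨fun h => ?_, fun h i => ?_⟩
  · simpa [generatedPattern] using h v.succ
  · by_cases hi : i = v.succ
    · subst hi
      simpa [generatedPattern] using h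
    · simp [generatedPattern, hi]

theorem le_patternTime_iff (v : Fin n) (ω : Ω) (m : ℕ) :
    (m : ℕ∞) ≤ patternTime G U v ω ↔ ∀ l < m, ω ∉ patternEvent G U v l := by
  constructor
  · intro h l hl hmem
    have hlt : (l : ℕ∞) < patternTime G U v ω := (Nat.cast_lt.2 hl).trans_le h
    exact notMem_of_lt_hittingAfter hlt (Nat.zero_le l)
      ((columnPairChain_mem_states_iff v l ω).2 hmem)
  · intro h
    by_contra! hlt
    obtain ⟨l, hl⟩ := ENat.ne_top_iff_exists.1 hlt.ne_top
    obtain ⟨j, hj, hmem⟩ := hittingAfter_le_iff.1 (show patternTime G U v ω ≤ (l : ℕ∞) from hl.ge)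
    rw [← hl, Nat.cast_lt] at hlt
    exact h j (hj.2.trans_lt hlt) ((columnPairChain_mem_states_iff v j ω).1 hmem)

theorem disjoint_patternEvent {u v : Fin n} (huv : u ≠ v) (m : ℕ) :
    Disjoint (patternEvent G U u m) (patternEvent G U v m) := by
  refine Set.disjoint_left.2 fun ω hu hv => huv (Fin.ext ?_)
  have h := (hu.1 0).symm.trans (hv.1 0)
  simpa [generatedPattern_entry_zero_zero] using h

/-- The two patterns clash at row `u.succ` of their common column m + 1. -/
theorem disjoint_patternEvent_succ {u v : Fin n} (h : ¬ G.Adj v u) (m : ℕ) :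
    Disjoint (patternEvent G U u m) (patternEvent G U v (m + 1)) :=
  Set.disjoint_left.2 fun _ hu hv =>
    h ((generatedPattern_entry_succ_zero_eq_iff G v u).1 ((hv.1 u.succ).symm.trans hu.2))

theorem measurableSet_letterAlgebra_patternEvent {S : Set (ℕ × Fin (n + 1))} (v : Fin n) (m : ℕ)
    (h0 : ∀ i, (m, i) ∈ S) (h1 : (m + 1, v.succ) ∈ S) :
    MeasurableSet[letterAlgebra U S] (patternEvent G U v m) := by
  have he : patternEvent G U v m =
      (⋂ i, {ω | (U m i ω : ℕ) = (generatedPattern G v).entry i 0}) ∩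
        {ω | (U (m + 1) v.succ ω : ℕ) = v + 1} := by
    ext ω; simp [patternEvent]
  rw [he]
  exact @MeasurableSet.inter _ (letterAlgebra U S) _ _
    (@MeasurableSet.iInter _ _ (letterAlgebra U S) _ _ fun i =>
      measurableSet_letterAlgebra_eq (h0 i) fun a => (a : ℕ) = (generatedPattern G v).entry i 0)
    (measurableSet_letterAlgebra_eq h1 fun a => (a : ℕ) = v + 1)

/-- A pattern at time l < m reads columns l and l + 1 ≤ m only. -/
theorem measurableSet_letterAlgebra_avoid_patternEvent (s : Set (Fin n)) (m : ℕ) :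
    MeasurableSet[letterAlgebra U {p | p.1 ≤ m}] (avoid (patternEvent G U) s m) := by
  rw [show avoid (patternEvent G U) s m = ⋂ u ∈ s, ⋂ l < m, (patternEvent G U u l)ᶜ by
    ext; simp [avoid]]
  refine @MeasurableSet.biInter _ _ (letterAlgebra U _) _ _ (Set.to_countable s) fun u _ =>
    @MeasurableSet.iInter _ _ (letterAlgebra U _) _ _ fun l =>
    @MeasurableSet.iInter _ _ (letterAlgebra U _) _ _ fun hl =>
    @MeasurableSet.compl _ _ (letterAlgebra U _)
      (measurableSet_letterAlgebra_patternEvent u l (fun i => ?_) ?_)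
  · exact hl.le
  · exact hl

/-- The first column of the pattern generated at `v`, as a column of letters. -/
noncomputable def patternColumn (hN : n + 1 ≤ N) (G : Digraph (Fin n)) (v : Fin n)
    (i : Fin (n + 1)) : Letter N :=
  ⟨(generatedPattern G v).entry i 0, Finset.mem_Icc.2
    ⟨(generatedPattern G v).first_pos i, ((generatedPattern G v).entry_le i 0).trans hN⟩⟩

/-- The letter `v + 1`, which the pattern generated at `v` has in its second column. -/
def patternLetter (hN : n + 1 ≤ N) (v : Fin n) : Letter N :=
  ⟨v + 1, Finset.mem_Icc.2 ⟨Nat.le_add_left 1 v, by have := v.isLt; omega⟩⟩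

theorem mem_patternEvent_iff (hN : n + 1 ≤ N) (v : Fin n) (m : ℕ) (ω : Ω) :
    ω ∈ patternEvent G U v m ↔ (∀ i, U m i ω = patternColumn hN G v i) ∧
      U (m + 1) v.succ ω = patternLetter hN v := by
  simp only [patternEvent, Set.mem_ofPred_eq, Subtype.ext_iff, patternColumn, patternLetter]

variable [MeasurableSpace Ω] {P : Measure Ω}

/-- Whatever the vertex, n + 1 letters of column `m` and one of column m + 1 are prescribed. -/
theorem IsUniformLetters.real_patternEvent (hU : IsUniformLetters P U) (hN : n + 1 ≤ N)
    (v : Fin n) (m : ℕ) : P.real (patternEvent G U v m) = (1 / (N : ℝ)) ^ (n + 2) := by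
  classical
  have hmem : (m + 1, v.succ) ∉ ({m} : Finset ℕ) ×ˢ (Finset.univ : Finset (Fin (n + 1))) := by
    simp
  have h := hU.real_cylinder (Finset.cons _ _ hmem) fun p =>
    if p.1 = m then patternColumn hN G v p.2 else patternLetter hN v
  rw [Finset.card_cons, Finset.card_product, Finset.card_singleton, Finset.card_univ,
    Fintype.card_fin, one_mul] at h
  rw [← h]
  congr 1
  ext ω
  simp [mem_patternEvent_iff hN, and_comm]

theorem IsUniformLetters.real_patternEvent_inter_succ_pos (hU : IsUniformLetters P U)
    [IsProbabilityMeasure P] (hN : n + 1 ≤ N) {u v : Fin n} (h : G.Adj v u) :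
    0 < P.real (patternEvent G U u 0 ∩ patternEvent G U v 1) := by
  have hN' : 0 < N := by omega
  have hpos : 0 < ((1 / (N : ℝ)) ^ (n + 1)) ^ 3 := by positivity
  -- Three prescribed columns realise both patterns; the arrow v → u makes column 1 contain the last
  -- letter required by `u`.
  rw [← hU.real_columns 3 fun l i => if l = 0 then patternColumn hN G u i else
    if l = 1 then patternColumn hN G v i else patternLetter hN v] at hpos
  refine hpos.trans_le (measureReal_mono fun ω hω => ?_)
  have h0 (i) : U 0 i ω = patternColumn hN G u i := hω 0 (by omega) i
  have h1 (i) : U 1 i ω = patternColumn hN G v i := hω 1 (by omega) i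
  have h2 (i) : U 2 i ω = patternLetter hN v := hω 2 (by omega) i
  refine ⟨(mem_patternEvent_iff hN u 0 ω).2 ⟨h0, ?_⟩,
    (mem_patternEvent_iff hN v 1 ω).2 ⟨h1, h2 _⟩⟩
  rw [zero_add, h1]
  exact Subtype.ext ((generatedPattern_entry_succ_zero_eq_iff G v u).2 h)

theorem IsUniformLetters.isUniformOccurrence (hU : IsUniformLetters P U) (hN : n + 1 ≤ N)
    (G : Digraph (Fin n)) :
    IsUniformOccurrence P (patternEvent G U) ((1 / (N : ℝ)) ^ (n + 2)) where
  measurable v m :=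
    (iSup₂_le fun p _ => (hU.measurable p.1 p.2).comap_le :
      letterAlgebra U Set.univ ≤ _) _ (measurableSet_letterAlgebra_patternEvent v m
        (fun _ => Set.mem_univ _) (Set.mem_univ _))
  prob := hU.real_patternEvent hN
  pos := by
    have : 0 < N := by omega
    positivity
  disjoint u v m huv := disjoint_patternEvent huv m
  indep s m v := by
    -- The past reads columns up to `m`, the pattern at time m + 1 only later ones.
    rw [hU.real_inter_eq_mul (S := {p | p.1 ≤ m}) (T := {p | m < p.1})
      (Set.disjoint_left.2 fun p (hp : p.1 ≤ m) (hp' : m < p.1) => hp.not_gt hp')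
      (measurableSet_letterAlgebra_avoid_patternEvent s m)
      (measurableSet_letterAlgebra_patternEvent v (m + 1) (fun _ => Nat.lt_succ_self m)
        (Nat.lt_succ_of_lt (Nat.lt_succ_self m))), hU.real_patternEvent hN]

theorem IsUniformLetters.rankingGraph_patternTime (hU : IsUniformLetters P U)
    [IsProbabilityMeasure P] (hN : n + 1 ≤ N) (hloop : ∀ i, ¬ G.Adj i i)
    (hcycle : ∀ i j, G.Adj i j → ¬ G.Adj j i) : rankingGraph P (patternTime G U) = G := by
  have hE := hU.isUniformOccurrence hN G
  have hself (i : Fin n) := disjoint_patternEvent_succ (U := U) (hloop i)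
  ext i j
  change 1 / 2 < P.real {ω | patternTime G U j ω < patternTime G U i ω} ↔ G.Adj i j
  rcases eq_or_ne i j with rfl | hij
  · simp [hloop i]
  have hsum := hE.real_first_time_lt_add le_patternTime_iff hij (hself i)
  constructor
  · intro hlt
    by_contra hadj
    -- Without the arrow i → j, `i` cannot directly follow `j`.
    have := hE.real_first_time_lt_le le_patternTime_iff hij (hself i)
      (disjoint_patternEvent_succ hadj)
    linarith
  · intro hadj
    -- Here `i` can directly follow `j`, but not conversely, as there is no 2-cycle.
    have := hE.real_first_time_lt_lt le_patternTime_iff hij.symm (hself j)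
      (disjoint_patternEvent_succ (hcycle i j hadj))
      (hU.real_patternEvent_inter_succ_pos hN hadj)
    linarith

end GeneratedPatterns

theorem theorem3p1 {n : ℕ} (G : Digraph (Fin n))
    (hloop : ∀ i, ¬ G.Adj i i)
    (hcycle : ∀ i j, G.Adj i j → ¬ G.Adj j i)
    (N : ℕ) (hN : n + 1 ≤ N) :
    (∃ (Ω : Type) (_ : MeasurableSpace Ω) (P : Measure Ω)
        (U : ℕ → Fin (n + 1) → Ω → Letter N),
        IsProbabilityMeasure P ∧ IsUniformLetters P U) ∧
    ∀ {Ω : Type*} [MeasurableSpace Ω] (P : Measure Ω) [IsProbabilityMeasure P]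
      (U : ℕ → Fin (n + 1) → Ω → Letter N), IsUniformLetters P U →
        IsOneDependentUniformChain P (columnPairChain U) ∧
        (∀ i, ∀ᵐ ω ∂P, patternTime G U i ω < ⊤) ∧
        (∀ i j, i ≠ j → P {ω | patternTime G U i ω = patternTime G U j ω} = 0) ∧
        (∀ i j, IdentDistrib (patternTime G U i) (patternTime G U j) P P) ∧
        rankingGraph P (patternTime G U) = G := by
  refine ⟨exists_isUniformLetters (by omega) (n + 1), fun P _ U hU => ?_⟩
  have hE := hU.isUniformOccurrence hN G
  have hself (i : Fin n) := disjoint_patternEvent_succ (U := U) (hloop i)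
  refine ⟨hU.isOneDependentUniformChain (by omega), fun i => ?_, fun i j hij => ?_,
    fun i j => ?_, hU.rankingGraph_patternTime hN hloop hcycle⟩
  · rw [ae_iff]
    simpa only [not_lt_top_iff] using hE.measure_first_time_eq_top le_patternTime_iff (hself i)
  · exact hE.measure_first_time_eq le_patternTime_iff hij (hself i)
  · exact hE.identDistrib_first_time le_patternTime_iff (hself i) (hself j)
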